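/- **Setting.** A mixed graph may contain directed edges $\to$, bidirected edges $\leftrightarrow$ and undirected edges $-$; two vertices may be joined by edges of several types. An edge is *incoming* at a vertex if it has an arrowhead there, *outgoing* if it has a tail there. A path (distinct vertices, consecutive ones joined by a chosen edge) is active with respect to $Z$ if every collider on it is in $Z$ or has a descendant in $Z$ and no inner non-collider is in $Z$; $x,y$ are m-separated given $Z$ if no path between them is active. A path between $x,y$ is inducing relative to $Z$ if every inner vertex outside $Z$ is a collider on it and every collider is an ancestor of $x$ or $y$. A maximal ancestral graph (MAG) is a mixed graph without directed cycles, without arrowheads at vertices that have an undirected edge, and without inducing paths relative to $\emptyset$ between distinct non-adjacent vertices. A partial ancestral graph (PAG) represents a set of Markov equivalent MAGs (same m-separations) by showing their adjacencies and the edge marks common to all of them. The five structures on a pair $(X,Y)$ are: (a) $X\to Y$; (b) $X\leftarrow Y$; (c) $X\leftrightarrow Y$ (a latent common cause); (d) $X\to Y$ and $X\leftrightarrow Y$; (e) $X\leftarrow Y$ and $X\leftrightarrow Y$. The *marginal causal structure* between $x\ne y$ in a mixed graph $H$ on $\mathcal V$ is the mixed graph on $\{x,y\}$ that has, for each collider-free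 path of $H$ between $x$ and $y$, an edge with the same marks at $x$ and $y$ as the path. It is said to be (a), ..., (e) if it is that graph (with $X=x$, $Y=y$) and this graph is moreover a marginal of $H$ in the sense of independences: if adjacent in it, $x,y$ are joined in $H$ by an inducing path relative to $\mathcal V\setminus\{x,y\}$, and every m-separation of it holds in $H$. **Algorithm (Causal IOD).** The input consists of datasets $D_1,\dots,D_n$ over variable sets $\mathcal V_1,\dots,\mathcal V_n$ with $\mathcal V=\bigcup_k\mathcal V_k$, conditional independence tests, and a bivariate causal discovery (BCD) algorithm; nothing is assumed about the verdicts of either. 1. (IOD, part 1.) Starting from complete unoriented graphs $\mathcal G_k$ on $\mathcal V_k$ and $\mathcal G$ on $\mathcal V$, edges are dropped according to the tests on each dataset (the independences found, with their conditioning sets, are stored in *Sepset*; the pairs of a dataset for which none was found are stored, with that dataset, in *IP*), and immoralities are oriented. 2. BCD is applied in each $D_k$ to the pairs with a not fully oriented edge in $\mathcal G_k$ (and possibly to further pairs of variables of $D_k$). The pairs for which it learns a structure are stored in *Directed* for (a), (b), *Common* for (c), *DirectedCommon* for (d), (e), ordered by the direction of the directed edge, and the graphs are oriented accordingly. 3.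 (IOD, part 2.) For every choice of a set of edges of $\mathcal G$ to remove, and of a set of immoralities to orient in the result, from among those that IOD designates for this, the PAGs of the Markov equivalence classes of MAGs compatible with the resulting graph (that is, the MAGs with its adjacencies and its known marks, and with no immoralities other than those oriented in it) are candidates, provided a MAG of the class has all m-separations in *Sepset*, and has, for every pair in *IP* with dataset $D_k$, an inducing path between them relative to $\mathcal V\setminus\mathcal V_k$. 4. A MAG is *consistent* if it meets the criterion below for row (a) for all $(x,y)$ in *Directed*, for row (c) for all pairs in *Common*, and for row (d) for all $(x,y)$ in *DirectedCommon*. A candidate PAG all of whose MAGs are consistent is returned; from any other candidate PAG its consistent MAGs are returned individually. The MAGs output are those returned individually and those of the PAGs returned. The criteria concern the m-separation of $x$ and $y$ given $\emptyset$ in the four graphs obtained by removing the incoming edges of $y$, the outgoing edges of $y$, the incoming edges of $x$, the outgoing edges of $x$, respectively: (a) separated, not, not, separated; (c) separated, not, separated, not; (d) separated, not, not, not. (Rows (b) and (e) are (a) and (d) with $x$ and $y$ exchanged.) **Theorem (Soundness).** Let $V_i\ne V_j$ be variables of a dataset $D_k$. If the BCD algorithm learned from $D_k$, in step 2, that the causal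 structure between $V_i$ and $V_j$ is (z), with $z\in\{a,b,c,d,e\}$, then the marginal causal structure between $V_i$ and $V_j$ is (z) in every MAG output by Causal IOD. -/

import Mathlib

/-! ### Mixed graphs, paths, m-separation, maximal ancestral graphs -/

/-- The mark that an edge carries at one of its two ends. -/
inductive Mark where
  | tail : Mark
  | arrow : Mark

/-- A mixed graph on `V`.  `edge a b x y` says that there is an edge between `x` and `y` which has
mark `a` at `x` and mark `b` at `y`: it is `x → y` for `(tail, arrow)`, `x ← y` for
`(arrow, tail)`, `x ↔ y` for `(arrow, arrow)` and `x - y` for `(tail, tail)`.  Two vertices may be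
joined by edges of several types, for instance by `x → y` and `x ↔ y`
(a direct cause together with a latent common cause). -/
@[ext]
structure MixedGraph (V : Type*) where
  edge : Mark → Mark → V → V → Prop
  symm : ∀ a b x y, edge a b x y → edge b a y x
  irrefl : ∀ a b x, ¬ edge a b x x

namespace MixedGraph

variable {V : Type*}

/-- Two vertices are adjacent if they share an edge. -/
def Adj (G : MixedGraph V) (x y : V) : Prop := ∃ a b, G.edge a b x y

/-- `x → y`. -/
def Dir (G : MixedGraph V) (x y : V) : Prop := G.edge Mark.tail Mark.arrow x y

/-- `y` is `x` itself or a descendant of `x`. -/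
def AncEq (G : MixedGraph V) : V → V → Prop := Relation.ReflTransGen G.Dir

/-- A path from `x` to `y`: a sequence of distinct vertices, starting at `x` and ending at `y`,
with, for consecutive vertices, an edge between them.  There are `len` inner vertices and `len + 1`
edges; the edge number `e` joins `node e.castSucc`, where its mark is `markL e`, to `node e.succ`,
where its mark is `markR e`. -/
structure Path (G : MixedGraph V) (x y : V) where
  len : ℕ
  node : Fin (len + 2) → V
  node_injective : Function.Injective node
  node_zero : node 0 = x
  node_last : node (Fin.last (len + 1)) = y
  markL : Fin (len + 1) → Mark
  markR : Fin (len + 1) → Mark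
  isEdge : ∀ e, G.edge (markL e) (markR e) (node e.castSucc) (node e.succ)

namespace Path

variable {G : MixedGraph V} {x y : V}

/-- The inner vertices of the path, in order. -/
def inner (p : G.Path x y) (i : Fin p.len) : V := p.node i.succ.castSucc

/-- The inner vertex number `i` is a collider: both path edges at it point at it. -/
def Collider (p : G.Path x y) (i : Fin p.len) : Prop :=
  p.markR i.castSucc = Mark.arrow ∧ p.markL i.succ = Mark.arrow

/-- The mark of the path at its first vertex. -/
def firstMark (p : G.Path x y) : Mark := p.markL 0

/-- The mark of the path at its last vertex. -/
def lastMark (p : G.Path x y) : Mark := p.markR (Fin.last p.len)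

/-- The path is active with respect to `Z` (a set that avoids both ends). -/
def Active (p : G.Path x y) (Z : Set V) : Prop :=
  ∀ i, (p.Collider i → ∃ w ∈ Z, G.AncEq (p.inner i) w) ∧ (p.inner i ∈ Z → p.Collider i)

/-- The path is inducing relative to `Z`. -/
def Inducing (p : G.Path x y) (Z : Set V) : Prop :=
  ∀ i, (p.inner i ∉ Z → p.Collider i) ∧
    (p.Collider i → G.AncEq (p.inner i) x ∨ G.AncEq (p.inner i) y)

/-- The same path, traversed backwards. -/
def reverse (p : G.Path x y) : G.Path y x where
  len := p.len
  node := fun i => p.node i.rev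
  node_injective := fun _ _ h => Fin.rev_injective (p.node_injective h)
  node_zero := by simpa using p.node_last
  node_last := by simpa using p.node_zero
  markL := fun e => p.markR e.rev
  markR := fun e => p.markL e.rev
  isEdge := fun e => by
    have h := G.symm _ _ _ _ (p.isEdge e.rev)
    rwa [← Fin.rev_succ, ← Fin.rev_castSucc] at h

theorem reverse_firstMark (p : G.Path x y) : p.reverse.firstMark = p.lastMark :=
  congrArg p.markR (Fin.rev_zero p.len)

theorem reverse_lastMark (p : G.Path x y) : p.reverse.lastMark = p.firstMark :=
  congrArg p.markL (Fin.rev_last p.len)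

theorem reverse_inner (p : G.Path x y) (i : Fin p.len) :
    p.reverse.inner i = p.inner i.rev := by
  simp only [inner, reverse]
  rw [Fin.rev_castSucc, Fin.rev_succ, Fin.succ_castSucc]

theorem reverse_collider (p : G.Path x y) (i : Fin p.len) :
    p.reverse.Collider i ↔ p.Collider i.rev := by
  simp only [Collider, reverse]
  rw [Fin.rev_castSucc, Fin.rev_succ]
  exact and_comm

theorem ne (p : G.Path x y) : x ≠ y := by
  intro h
  have h0 : p.node 0 = p.node (Fin.last (p.len + 1)) := by
    rw [p.node_zero, p.node_last, h]
  have h1 := congrArg Fin.val (p.node_injective h0)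
  simp at h1

end Path

/-- `x` and `y` are m-separated given `Z`. -/
def MSep (G : MixedGraph V) (x y : V) (Z : Set V) : Prop := ∀ p : G.Path x y, ¬ p.Active Z

/-- Maximal ancestral graphs.  No directed cycles; no arrowhead at a vertex that has an undirected
edge; non-adjacent vertices are not joined by an inducing path relative to the empty set. -/
structure IsMAG (G : MixedGraph V) : Prop where
  acyclic : ∀ x, ¬ Relation.TransGen G.Dir x x
  no_arrow : ∀ x y, G.edge Mark.tail Mark.tail x y → ∀ a w, ¬ G.edge Mark.arrow a x w
  maximal : ∀ x y, x ≠ y → ¬ G.Adj x y → ∀ p : G.Path x y, ¬ p.Inducing ∅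

/-- Markov equivalence: the same m-separations. -/
def MarkovEquiv (G H : MixedGraph V) : Prop :=
  ∀ x y Z, x ≠ y → x ∉ Z → y ∉ Z → (G.MSep x y Z ↔ H.MSep x y Z)

/-- `x, z, y` is an immorality: a collider at `z` whose ends are not adjacent. -/
def Immorality (G : MixedGraph V) (x z y : V) : Prop :=
  x ≠ y ∧ ¬ G.Adj x y ∧ (∃ a, G.edge a Mark.arrow x z) ∧ (∃ a, G.edge a Mark.arrow y z)

/-- All edges that have mark `m` at `z` are deleted. -/
def cut (G : MixedGraph V) (m : Mark) (z : V) : MixedGraph V where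
  edge a b x y := G.edge a b x y ∧ ¬ (x = z ∧ a = m) ∧ ¬ (y = z ∧ b = m)
  symm a b x y h := ⟨G.symm a b x y h.1, h.2.2, h.2.1⟩
  irrefl a b x h := G.irrefl a b x h.1

/-- The incoming edges of `z` (those with an arrowhead at `z`) are removed. -/
abbrev removeIncoming (G : MixedGraph V) (z : V) : MixedGraph V := G.cut Mark.arrow z

/-- The outgoing edges of `z` (those with a tail at `z`) are removed. -/
abbrev removeOutgoing (G : MixedGraph V) (z : V) : MixedGraph V := G.cut Mark.tail z

/-- The causal structure that `G` induces on the vertices in `W` when the other vertices become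
latent (latent projection): `x, y ∈ W` get an edge with marks `a`, `b` for every path of `G`
between them through `Wᶜ` which has no collider, and has mark `a` at `x` and mark `b` at `y`.
So `x → y` for a directed path through latent vertices, and `x ↔ y` for a confounding path, such as
`x ← ⋯ ← w → ⋯ → y`. -/
def marginal (G : MixedGraph V) (W : Set V) : MixedGraph W where
  edge a b x y := ∃ p : G.Path (x : V) (y : V),
    p.firstMark = a ∧ p.lastMark = b ∧ ∀ i, p.inner i ∉ W ∧ ¬ p.Collider i
  symm := by
    rintro a b x y ⟨p, ha, hb, h⟩
    refine ⟨p.reverse, by rw [p.reverse_firstMark, hb], by rw [p.reverse_lastMark, ha], ?_⟩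
    intro i
    exact ⟨fun hi => (h (Fin.rev i)).1 (p.reverse_inner i ▸ hi),
      fun hi => (h (Fin.rev i)).2 ((p.reverse_collider i).1 hi)⟩
  irrefl := by
    rintro a b x ⟨p, -⟩
    exact p.ne rfl

/-- The independence part of being a marginal: adjacent vertices of `H` are joined in `G` by an
inducing path relative to the vertices that `H` lacks, and m-separations of `H` hold in `G`. -/
def IsMarginalOf {W : Set V} (H : MixedGraph W) (G : MixedGraph V) : Prop :=
  ∀ x y : W, x ≠ y →
    (H.Adj x y → ∃ p : G.Path (x : V) (y : V), p.Inducing Wᶜ) ∧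
    ∀ Z : Set W, x ∉ Z → y ∉ Z → H.MSep x y Z → G.MSep x y (Subtype.val '' Z)

end MixedGraph

/-! ### The five causal structures on a pair of correlated variables -/

/-- The causal structures between two correlated variables `X`, `Y`. -/
inductive PairStructure where
  /-- `X → Y` -/
  | directXY : PairStructure
  /-- `X ← Y` -/
  | directYX : PairStructure
  /-- a latent common cause of `X` and `Y` -/
  | common : PairStructure
  /-- `X → Y` and a latent common cause -/
  | directCommonXY : PairStructure
  /-- `X ← Y` and a latent common cause -/
  | directCommonYX : PairStructure

namespace PairStructure

/-- The edges of the structure: `z.Marks a b` says that there is an edge with mark `a` at `X` and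
mark `b` at `Y`; a latent common cause is a bidirected edge. -/
def Marks : PairStructure → Mark → Mark → Prop
  | directXY, a, b => a = Mark.tail ∧ b = Mark.arrow
  | directYX, a, b => a = Mark.arrow ∧ b = Mark.tail
  | common, a, b => a = Mark.arrow ∧ b = Mark.arrow
  | directCommonXY, _, b => b = Mark.arrow
  | directCommonYX, a, _ => a = Mark.arrow

/-- The structure as a mixed graph on `{x, y}`, with `x` for `X` and `y` for `Y`. -/
def graph {V : Type*} (z : PairStructure) (x y : V) : MixedGraph ({x, y} : Set V) where
  edge a b u v := u ≠ v ∧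
    (((u : V) = x ∧ (v : V) = y ∧ z.Marks a b) ∨ ((u : V) = y ∧ (v : V) = x ∧ z.Marks b a))
  symm := by
    rintro a b u v ⟨hne, ⟨hu, hv, h⟩ | ⟨hu, hv, h⟩⟩
    · exact ⟨hne.symm, Or.inr ⟨hv, hu, h⟩⟩
    · exact ⟨hne.symm, Or.inl ⟨hv, hu, h⟩⟩
  irrefl _ _ _ h := h.1 rfl

/-- The criterion that is to pick out the structure: m-separation of `x` and `y` given the empty
set, in the graph with the incoming or the outgoing edges of `y` or of `x` removed. -/
def Criterion {V : Type*} : PairStructure → MixedGraph V → V → V → Prop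
  | directXY, G, x, y =>
      (G.removeIncoming y).MSep x y ∅ ∧ ¬ (G.removeOutgoing y).MSep x y ∅ ∧
      ¬ (G.removeIncoming x).MSep x y ∅ ∧ (G.removeOutgoing x).MSep x y ∅
  | directYX, G, x, y =>
      ¬ (G.removeIncoming y).MSep x y ∅ ∧ (G.removeOutgoing y).MSep x y ∅ ∧
      (G.removeIncoming x).MSep x y ∅ ∧ ¬ (G.removeOutgoing x).MSep x y ∅
  | common, G, x, y =>
      (G.removeIncoming y).MSep x y ∅ ∧ ¬ (G.removeOutgoing y).MSep x y ∅ ∧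
      (G.removeIncoming x).MSep x y ∅ ∧ ¬ (G.removeOutgoing x).MSep x y ∅
  | directCommonXY, G, x, y =>
      (G.removeIncoming y).MSep x y ∅ ∧ ¬ (G.removeOutgoing y).MSep x y ∅ ∧
      ¬ (G.removeIncoming x).MSep x y ∅ ∧ ¬ (G.removeOutgoing x).MSep x y ∅
  | directCommonYX, G, x, y =>
      ¬ (G.removeIncoming y).MSep x y ∅ ∧ ¬ (G.removeOutgoing y).MSep x y ∅ ∧
      (G.removeIncoming x).MSep x y ∅ ∧ ¬ (G.removeOutgoing x).MSep x y ∅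

end PairStructure

/-- The marginal causal structure between `x` and `y` in `G` is `z`. -/
def MixedGraph.HasMarginalStructure {V : Type*} (G : MixedGraph V) (x y : V)
    (z : PairStructure) : Prop :=
  x ≠ y ∧ G.marginal {x, y} = z.graph x y ∧ (z.graph x y).IsMarginalOf G

/-! ### Partially oriented graphs and partial ancestral graphs -/

/-- A partially oriented graph.  `known m x y` says that the edge between `x` and `y` is known to
have mark `m` at `x`; a mark that is not known is a circle.  (Of no meaning if `x`, `y` are not
adjacent.) -/
structure PartialGraph (V : Type*) where
  adj : V → V → Prop
  symm : ∀ x y, adj x y → adj y x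
  irrefl : ∀ x, ¬ adj x x
  known : Mark → V → V → Prop

namespace PartialGraph

variable {V : Type*}

/-- The edge between `x` and `y` is not fully oriented: it has a circle at `x` or at `y`. -/
def Unoriented (P : PartialGraph V) (x y : V) : Prop :=
  P.adj x y ∧ ((∀ m, ¬ P.known m x y) ∨ (∀ m, ¬ P.known m y x))

/-- `x` and `y` are adjacent to `z` but not to each other. -/
def Unshielded (P : PartialGraph V) (x z y : V) : Prop :=
  x ≠ y ∧ P.adj x z ∧ P.adj z y ∧ ¬ P.adj x y

/-- More marks become known. -/
def orient (P : PartialGraph V) (new : Mark → V → V → Prop) : PartialGraph V where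
  adj := P.adj
  symm := P.symm
  irrefl := P.irrefl
  known m x y := P.known m x y ∨ new m x y

/-- The edges in `R` are removed. -/
def remove (P : PartialGraph V) (R : Set (Sym2 V)) : PartialGraph V where
  adj x y := P.adj x y ∧ s(x, y) ∉ R
  symm x y h := ⟨P.symm x y h.1, by rw [Sym2.eq_swap]; exact h.2⟩
  irrefl x h := P.irrefl x h.1
  known := P.known

/-- The triples `x, z, y` in `I` are made immoralities, by arrowheads at `z`. -/
def orientImmoralities (P : PartialGraph V) (I : Set (V × V × V)) : PartialGraph V :=
  P.orient fun m z x => m = Mark.arrow ∧ ∃ y, (x, z, y) ∈ I ∨ (y, z, x) ∈ I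

/-- `H` is a maximal ancestral graph with the adjacencies of `P`, with the marks known in `P`, and
with no immoralities besides those oriented in `P`. -/
structure Fits (P : PartialGraph V) (H : MixedGraph V) : Prop where
  isMAG : H.IsMAG
  adj_iff : ∀ x y, H.Adj x y ↔ P.adj x y
  known : ∀ m x y a b, P.known m x y → H.edge a b x y → a = m
  immorality : ∀ x z y, H.Immorality x z y → P.known Mark.arrow z x ∧ P.known Mark.arrow z y

end PartialGraph

/-- A partial ancestral graph, with the set of Markov equivalent maximal ancestral graphs that it
represents: it has their adjacencies, and shows exactly the invariant marks. -/
structure PAG (V : Type*) where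
  graph : PartialGraph V
  mags : Set (MixedGraph V)
  nonempty : mags.Nonempty
  isMAG : ∀ H ∈ mags, H.IsMAG
  equiv : ∀ H ∈ mags, ∀ H' ∈ mags, H.MarkovEquiv H'
  adj_iff : ∀ H ∈ mags, ∀ x y, H.Adj x y ↔ graph.adj x y
  known_iff : ∀ m x y, graph.known m x y ↔
    graph.adj x y ∧ ∀ H ∈ mags, ∀ a b, H.edge a b x y → a = m

/-! ### The algorithm -/

/-- A dataset: the variables that are jointly measured, and their sampled values. -/
structure Dataset (V α : Type*) where
  vars : Finset V
  sample : List (vars → α)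

/-- Choices left open by the description of the IOD algorithm; nothing is assumed about them. -/
structure SearchRules (V : Type*) (n : ℕ) where
  /-- the conditioning sets that are tried for a pair of variables in a dataset -/
  tested : Fin n → Sym2 V → Set (Set V)
  /-- the edges to remove, computed from the global graph and the graphs of the datasets -/
  edgesToRemove : PartialGraph V → (Fin n → PartialGraph V) → Set (Sym2 V)
  /-- the immoralities to orient, computed likewise after the removal of edges -/
  immoralitiesToOrient : PartialGraph V → (Fin n → PartialGraph V) → Set (V × V × V)

/-- The input of the Causal IOD algorithm.  Nothing is assumed about the verdicts of the tests. -/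
structure CausalIOD (V α : Type*) (n : ℕ) where
  /-- the datasets -/
  data : Fin n → Dataset V α
  /-- every variable is measured in some dataset -/
  cover : ∀ v, ∃ k, v ∈ (data k).vars
  /-- the conditional independence test: whether, for the dataset `k`, the two variables are found
  independent given a set (it may pool the datasets) -/
  indep : (Fin n → Dataset V α) → Fin n → Sym2 V → Set V → Prop
  /-- the choices made by the IOD algorithm -/
  rules : SearchRules V n
  /-- the bivariate causal discovery algorithm: the structure that it finds between two variables
  of a dataset, if it finds one -/
  bcd : Dataset V α → V → V → Option PairStructure
  /-- jointly measured pairs that are submitted to it besides those with an unoriented edge -/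
  alsoSubmitted : Fin n → V → V → Prop

namespace CausalIOD

variable {V α : Type*} {n : ℕ} (I : CausalIOD V α n)

/-- The variables of dataset `k`. -/
def vars (k : Fin n) : Set V := {v | v ∈ (I.data k).vars}

/-! #### Part 1 of IOD -/

/-- The conditional independences found: dataset, pair of its variables, conditioning set. -/
def sepset : Set (Fin n × Sym2 V × Set V) :=
  {t | ¬ t.2.1.IsDiag ∧ (∀ v ∈ t.2.1, v ∈ I.vars t.1) ∧
    t.2.2 ⊆ I.vars t.1 ∧ (∀ v ∈ t.2.1, v ∉ t.2.2) ∧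
    t.2.2 ∈ I.rules.tested t.1 t.2.1 ∧ I.indep I.data t.1 t.2.1 t.2.2}

/-- The pairs of variables of a dataset for which no conditional independence was found. -/
def ip : Set (Fin n × Sym2 V) :=
  {t | ¬ t.2.IsDiag ∧ (∀ v ∈ t.2, v ∈ I.vars t.1) ∧ ∀ S, (t.1, t.2, S) ∉ I.sepset}

/-- The complete unoriented graph on the variables of dataset `k`, after the removal of edges.
(The variables that are not in the dataset are isolated vertices.) -/
def localSkeleton (k : Fin n) : PartialGraph V where
  adj x y := (k, s(x, y)) ∈ I.ip
  symm x y h := by rwa [Sym2.eq_swap]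
  irrefl x h := h.1 (by simp)
  known _ _ _ := False

/-- An immorality found in dataset `k`: `z` is in no set that separates `x` and `y`. -/
def FoundImmorality (k : Fin n) (x z y : V) : Prop :=
  (I.localSkeleton k).Unshielded x z y ∧ ∀ S, (k, s(x, y), S) ∈ I.sepset → z ∉ S

/-- The graph of dataset `k`. -/
def localGraph (k : Fin n) : PartialGraph V :=
  (I.localSkeleton k).orientImmoralities {t | I.FoundImmorality k t.1 t.2.1 t.2.2}

/-- The complete unoriented graph on all variables, after the removal of edges. -/
def globalSkeleton : PartialGraph V where
  adj x y := x ≠ y ∧ ∀ k S, (k, s(x, y), S) ∉ I.sepset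
  symm x y h := ⟨h.1.symm, by rw [Sym2.eq_swap]; exact h.2⟩
  irrefl _ h := h.1 rfl
  known _ _ _ := False

/-- The graph on all variables. -/
def globalGraph : PartialGraph V :=
  I.globalSkeleton.orientImmoralities
    {t | (∃ k, I.FoundImmorality k t.1 t.2.1 t.2.2) ∧
      I.globalSkeleton.Unshielded t.1 t.2.1 t.2.2}

/-! #### Bivariate causal discovery -/

/-- The algorithm applied bivariate causal discovery to the distinct variables `x`, `y` of dataset
`k`, and learned the structure `z`. -/
def Learned (k : Fin n) (x y : V) (z : PairStructure) : Prop :=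
  x ≠ y ∧ x ∈ I.vars k ∧ y ∈ I.vars k ∧
    ((I.localGraph k).Unoriented x y ∨ I.alsoSubmitted k x y) ∧ I.bcd (I.data k) x y = some z

/-- Mark `m` at `x`, for the edge between `x` and `y`, according to a learned structure; that is,
all edges of the learned structure have this mark. -/
def LearnedMark (m : Mark) (x y : V) : Prop :=
  ∃ k z, (I.Learned k x y z ∧ ∀ a b, z.Marks a b → a = m) ∨
    (I.Learned k y x z ∧ ∀ a b, z.Marks a b → b = m)

/-- The global graph, oriented by the learned structures. -/
def orientedGlobalGraph : PartialGraph V := I.globalGraph.orient I.LearnedMark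

/-- The graph of dataset `k`, oriented by the learned structures. -/
def orientedLocalGraph (k : Fin n) : PartialGraph V := (I.localGraph k).orient I.LearnedMark

/-- The pairs `(x, y)` for which `x → y` was learned. -/
def directed : Set (V × V) :=
  {t | ∃ k, I.Learned k t.1 t.2 .directXY ∨ I.Learned k t.2 t.1 .directYX}

/-- The pairs for which a latent common cause was learned. -/
def commonCause : Set (V × V) :=
  {t | ∃ k, I.Learned k t.1 t.2 .common}

/-- The pairs `(x, y)` for which `x → y` together with a latent common cause was learned. -/
def directedCommon : Set (V × V) :=
  {t | ∃ k, I.Learned k t.1 t.2 .directCommonXY ∨ I.Learned k t.2 t.1 .directCommonYX}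

/-! #### Part 2 of IOD -/

/-- The graphs obtained from the global graph by removing some of the edges to remove, and then
orienting some of the immoralities to orient. -/
def searchGraphs : Set (PartialGraph V) :=
  {Q | ∃ R ⊆ I.rules.edgesToRemove I.orientedGlobalGraph I.orientedLocalGraph,
    ∃ T ⊆ I.rules.immoralitiesToOrient (I.orientedGlobalGraph.remove R) I.orientedLocalGraph,
      (∀ t ∈ T, (I.orientedGlobalGraph.remove R).Unshielded t.1 t.2.1 t.2.2) ∧
      Q = (I.orientedGlobalGraph.remove R).orientImmoralities T}

/-- The test of a candidate: it is a maximal ancestral graph, it has the m-separations stored in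
`sepset`, and every pair stored in `ip` is joined by an inducing path relative to the variables
outside the dataset. -/
structure Passes (H : MixedGraph V) : Prop where
  isMAG : H.IsMAG
  sepset : ∀ k x y S, (k, s(x, y), S) ∈ I.sepset → H.MSep x y S
  ip : ∀ k x y, (k, s(x, y)) ∈ I.ip → ∃ p : H.Path x y, p.Inducing (I.vars k)ᶜ

/-- The partial ancestral graphs returned by IOD: those of the Markov equivalence classes that fit
one of the graphs of the search, and of which a member passes the test. -/
def candidates : Set (PAG V) :=
  {P | ∃ Q ∈ I.searchGraphs, ∃ M, Q.Fits M ∧ I.Passes M ∧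
    P.mags = {H | Q.Fits H ∧ M.MarkovEquiv H}}

/-! #### The filter and the output -/

/-- The criteria hold in `H` for all pairs in the three data structures. -/
structure Consistent (H : MixedGraph V) : Prop where
  directed : ∀ t ∈ I.directed, PairStructure.directXY.Criterion H t.1 t.2
  common : ∀ t ∈ I.commonCause, PairStructure.common.Criterion H t.1 t.2
  directedCommon : ∀ t ∈ I.directedCommon, PairStructure.directCommonXY.Criterion H t.1 t.2

/-- The partial ancestral graphs returned: the candidates all of whose members are consistent. -/
def returnedPAGs : Set (PAG V) :=
  {P | P ∈ I.candidates ∧ ∀ H ∈ P.mags, I.Consistent H}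

/-- The graphs returned individually: the consistent members of the other candidates. -/
def returnedMAGs : Set (MixedGraph V) :=
  {H | ∃ P ∈ I.candidates, ¬ (∀ H' ∈ P.mags, I.Consistent H') ∧ H ∈ P.mags ∧ I.Consistent H}

/-- The maximal ancestral graphs output by the algorithm, individually or in a returned partial
ancestral graph. -/
def output : Set (MixedGraph V) :=
  {H | H ∈ I.returnedMAGs ∨ ∃ P ∈ I.returnedPAGs, H ∈ P.mags}

end CausalIOD

/-! Deleting the edges with mark `m` at an end of a pair keeps exactly the paths between `x` and `y`
whose mark at that end is not `m`, and such a path is active given `∅` exactly if it has no collider.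
So each of the four m-separations in a criterion says whether some collider-free path has a tail, or
an arrowhead, at `x`, or at `y` (`MixedGraph.msep_cut_right_iff`, `MixedGraph.msep_cut_left_iff`).
For each structure these four facts determine which pairs of end marks occur on collider-free paths
(`PairStructure.Criterion.linked_iff`), which is what the marginal on `{x, y}` records.  Some
collider-free path exists; it is inducing relative to all other vertices, and the m-separations of
the marginal all hold because its two vertices are adjacent.  Every graph that is output is
consistent, hence meets the criterion of every learned structure. -/

theorem Mark.forall_iff {P : Mark → Prop} : (∀ m, P m) ↔ P .tail ∧ P .arrow :=
  ⟨fun h => ⟨h _, h _⟩, fun h m => by cases m <;> simp [h]⟩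

theorem Mark.exists_iff {P : Mark → Prop} : (∃ m, P m) ↔ P .tail ∨ P .arrow := by
  rw [← not_iff_not, not_exists, not_or, Mark.forall_iff]

namespace MixedGraph

variable {V : Type*} {G : MixedGraph V} {x y : V}

namespace Path

theorem active_empty_iff (p : G.Path x y) : p.Active ∅ ↔ ∀ i, ¬ p.Collider i := by
  simp [Active]

theorem Active.reverse {p : G.Path x y} {Z : Set V} (h : p.Active Z) : p.reverse.Active Z := by
  intro (i : Fin p.len)
  rw [p.reverse_collider, p.reverse_inner]
  exact h i.rev

theorem inner_ne_left (p : G.Path x y) (i : Fin p.len) : p.inner i ≠ x := by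
  intro h
  have h' := congrArg Fin.val (p.node_injective (h.trans p.node_zero.symm))
  simp at h'

theorem inner_ne_right (p : G.Path x y) (i : Fin p.len) : p.inner i ≠ y := by
  intro h
  have h' := congrArg Fin.val (p.node_injective (h.trans p.node_last.symm))
  have := i.isLt
  simp at h'
  omega

theorem node_castSucc_ne_right (p : G.Path x y) (e : Fin (p.len + 1)) :
    p.node e.castSucc ≠ y := fun h =>
  (Fin.castSucc_lt_last e).ne (p.node_injective (h.trans p.node_last.symm))

theorem eq_last_of_node_succ_eq (p : G.Path x y) {e : Fin (p.len + 1)} (h : p.node e.succ = y) :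
    e = Fin.last p.len :=
  Fin.succ_injective _ (p.node_injective (h.trans p.node_last.symm))

/-- The single edge between `x` and `y`, as a path. -/
def ofEdge {a b : Mark} (hne : x ≠ y) (h : G.edge a b x y) : G.Path x y where
  len := 0
  node := ![x, y]
  node_injective := by
    intro i j hij
    fin_cases i <;> fin_cases j <;> simp_all
  node_zero := rfl
  node_last := rfl
  markL _ := a
  markR _ := b
  isEdge e := by
    obtain rfl : e = 0 := Fin.eq_zero e
    exact h

end Path

theorem msep_comm {Z : Set V} : G.MSep x y Z ↔ G.MSep y x Z :=
  ⟨fun h p hp => h p.reverse hp.reverse, fun h p hp => h p.reverse hp.reverse⟩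

/-- `x` and `y` are joined by a collider-free path with mark `a` at `x` and mark `b` at `y`. -/
def Linked (G : MixedGraph V) (a b : Mark) (x y : V) : Prop :=
  ∃ p : G.Path x y, p.firstMark = a ∧ p.lastMark = b ∧ ∀ i, ¬ p.Collider i

theorem Linked.symm {a b : Mark} (h : G.Linked a b x y) : G.Linked b a y x := by
  obtain ⟨p, ha, hb, hp⟩ := h
  exact ⟨p.reverse, p.reverse_firstMark.trans hb, p.reverse_lastMark.trans ha,
    fun i hi => hp i.rev ((p.reverse_collider i).1 hi)⟩

theorem linked_comm {a b : Mark} : G.Linked a b x y ↔ G.Linked b a y x :=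
  ⟨Linked.symm, Linked.symm⟩

theorem msep_cut_right_iff {m : Mark} :
    (G.cut m y).MSep x y ∅ ↔ ∀ a b, G.Linked a b x y → b = m := by
  constructor
  · rintro h a b ⟨p, -, rfl, hp⟩
    by_contra hm
    -- Only the last edge of `p` touches `y`, so `p` survives the deletion.
    refine h ⟨p.len, p.node, p.node_injective, p.node_zero, p.node_last, p.markL, p.markR,
      fun e => ⟨p.isEdge e, fun he => p.node_castSucc_ne_right e he.1, ?_⟩⟩
      ((Path.active_empty_iff _).2 hp)
    rintro ⟨he, hme⟩
    exact hm (by rw [Path.lastMark, ← p.eq_last_of_node_succ_eq he, hme])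
  · intro h p hp
    have hlast := p.isEdge (Fin.last p.len)
    refine hlast.2.2 ⟨p.node_last, h p.firstMark p.lastMark ⟨⟨p.len, p.node, p.node_injective,
      p.node_zero, p.node_last, p.markL, p.markR, fun e => (p.isEdge e).1⟩, rfl, rfl, ?_⟩⟩
    exact p.active_empty_iff.1 hp

theorem msep_cut_left_iff {m : Mark} :
    (G.cut m x).MSep x y ∅ ↔ ∀ a b, G.Linked a b x y → a = m := by
  rw [msep_comm, msep_cut_right_iff]
  exact ⟨fun h a b hab => h b a hab.symm, fun h a b hab => h b a hab.symm⟩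

/-- The vertices in between avoid `{x, y}` automatically, as vertices of a path are distinct. -/
theorem marginal_pair_edge_iff {a b : Mark} {u v : ({x, y} : Set V)}
    (huv : ((u : V) = x ∧ (v : V) = y) ∨ ((u : V) = y ∧ (v : V) = x)) :
    (G.marginal {x, y}).edge a b u v ↔ G.Linked a b (u : V) (v : V) := by
  constructor
  · rintro ⟨p, ha, hb, hp⟩
    exact ⟨p, ha, hb, fun i => (hp i).2⟩
  · rintro ⟨p, ha, hb, hp⟩
    refine ⟨p, ha, hb, fun i => ⟨?_, hp i⟩⟩
    have h₁ := p.inner_ne_left i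
    have h₂ := p.inner_ne_right i
    rintro (hi | hi) <;> rcases huv with ⟨hu, hv⟩ | ⟨hu, hv⟩ <;> simp_all

end MixedGraph

namespace PairStructure

variable {V : Type*} {G : MixedGraph V} {x y : V}

open MixedGraph

theorem Criterion.linked_iff {z : PairStructure} (h : z.Criterion G x y) (a b : Mark) :
    G.Linked a b x y ↔ z.Marks a b := by
  cases z <;> simp only [Criterion, removeIncoming, removeOutgoing, msep_cut_right_iff,
    msep_cut_left_iff, Mark.forall_iff] at h <;>
    cases a <;> cases b <;> simp_all [Marks]

theorem exists_marks (z : PairStructure) : ∃ a b, z.Marks a b := by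
  cases z <;> simp [Marks, Mark.exists_iff]

theorem graph_edge_iff {z : PairStructure} (hne : x ≠ y) {a b : Mark} {u v : ({x, y} : Set V)}
    (hu : (u : V) = x) (hv : (v : V) = y) : (z.graph x y).edge a b u v ↔ z.Marks a b := by
  have huv : u ≠ v := fun h => hne (hu.symm.trans ((congrArg Subtype.val h).trans hv))
  simp [graph, huv, hu, hv, hne]

theorem Criterion.marginal_eq {z : PairStructure} (hne : x ≠ y) (h : z.Criterion G x y) :
    G.marginal {x, y} = z.graph x y := by
  ext a b ⟨u, hu⟩ ⟨v, hv⟩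
  rcases hu with rfl | rfl <;> rcases hv with rfl | rfl
  · exact iff_of_false (MixedGraph.irrefl _ _ _ _) (MixedGraph.irrefl _ _ _ _)
  · rw [marginal_pair_edge_iff (Or.inl ⟨rfl, rfl⟩), graph_edge_iff hne rfl rfl, h.linked_iff]
  · rw [marginal_pair_edge_iff (Or.inr ⟨rfl, rfl⟩), linked_comm, h.linked_iff,
      ← graph_edge_iff (u := ⟨v, Or.inl rfl⟩) (v := ⟨u, Or.inr rfl⟩) hne rfl rfl]
    exact ⟨MixedGraph.symm _ _ _ _ _, MixedGraph.symm _ _ _ _ _⟩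
  · exact iff_of_false (MixedGraph.irrefl _ _ _ _) (MixedGraph.irrefl _ _ _ _)

theorem graph_adj (z : PairStructure) {u v : ({x, y} : Set V)} (huv : u ≠ v) :
    (z.graph x y).Adj u v := by
  obtain ⟨a, b, hab⟩ := z.exists_marks
  obtain ⟨u, rfl | rfl⟩ := u <;> obtain ⟨v, rfl | rfl⟩ := v
  · exact absurd rfl huv
  · exact ⟨a, b, huv, Or.inl ⟨rfl, rfl, hab⟩⟩
  · exact ⟨b, a, huv, Or.inr ⟨rfl, rfl, hab⟩⟩
  · exact absurd rfl huv

theorem not_graph_msep (z : PairStructure) {u v : ({x, y} : Set V)} (huv : u ≠ v)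
    (Z : Set ({x, y} : Set V)) : ¬ (z.graph x y).MSep u v Z := by
  obtain ⟨a, b, hab⟩ := z.graph_adj huv
  exact fun h => h (Path.ofEdge huv hab) fun i => i.elim0

theorem Criterion.isMarginalOf {z : PairStructure} (hne : x ≠ y) (h : z.Criterion G x y) :
    (z.graph x y).IsMarginalOf G := by
  intro u v huv
  refine ⟨fun ⟨a, b, hab⟩ => ?_, fun Z _ _ hZ => absurd hZ (z.not_graph_msep huv Z)⟩
  rw [← h.marginal_eq hne] at hab
  obtain ⟨p, -, -, hp⟩ := hab
  exact ⟨p, fun i => ⟨fun hi => absurd (hp i).1 hi, fun hi => absurd hi (hp i).2⟩⟩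

theorem Criterion.hasMarginalStructure {z : PairStructure} (hne : x ≠ y)
    (h : z.Criterion G x y) : G.HasMarginalStructure x y z :=
  ⟨hne, h.marginal_eq hne, h.isMarginalOf hne⟩

theorem Criterion.directYX (h : Criterion directXY G x y) : Criterion directYX G y x := by
  simp only [Criterion, msep_comm (x := y)] at h ⊢
  tauto

theorem Criterion.directCommonYX (h : Criterion directCommonXY G x y) :
    Criterion directCommonYX G y x := by
  simp only [Criterion, msep_comm (x := y)] at h ⊢
  tauto

end PairStructure

namespace CausalIOD

variable {V α : Type*} {n : ℕ} {I : CausalIOD V α n} {H : MixedGraph V}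

theorem consistent_of_mem_output (h : H ∈ I.output) : I.Consistent H := by
  rcases h with ⟨_, _, _, _, hc⟩ | ⟨_, ⟨_, hc⟩, hH⟩
  · exact hc
  · exact hc H hH

theorem Consistent.criterion (h : I.Consistent H) {k : Fin n} {i j : V} {z : PairStructure}
    (hz : I.Learned k i j z) : z.Criterion H i j := by
  cases z with
  | directXY => exact h.directed (i, j) ⟨k, Or.inl hz⟩
  | directYX => exact (h.directed (j, i) ⟨k, Or.inr hz⟩).directYX
  | common => exact h.common (i, j) ⟨k, hz⟩
  | directCommonXY => exact h.directedCommon (i, j) ⟨k, Or.inl hz⟩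
  | directCommonYX => exact (h.directedCommon (j, i) ⟨k, Or.inr hz⟩).directCommonYX

end CausalIOD

theorem theorem1 {V α : Type*} {n : ℕ} (I : CausalIOD V α n) (k : Fin n) (i j : V)
    (z : PairStructure) (hz : I.Learned k i j z) :
    ∀ H ∈ I.output, H.HasMarginalStructure i j z := by
  intro H hH
  exact ((CausalIOD.consistent_of_mem_output hH).criterion hz).hasMarginalStructure hz.1
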